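/- Let $N$ be a free abelian group of rank $4$, $M=\mathrm{Hom}(N,\mathbb Z)$, $N_{\mathbb R}=N\otimes\mathbb R$, and let $\sigma\subseteq N_{\mathbb R}$ be a strongly convex rational polyhedral cone which is nondegenerate (i.e. spans $N_{\mathbb R}$). For such a cone $\tau$ (nondegenerate or not), let $\mathrm{Gen}(\tau)\subset N$ be the set of primitive generators of its one-dimensional faces. The cone $\tau$ is called smooth if $\mathrm{Gen}(\tau)$ is part of a $\mathbb Z$-basis of $N$, and singular otherwise. Let $X_\sigma=\mathrm{Spec}\,k[\sigma^\vee\cap M]$ be the associated four-dimensional affine toric variety over a field $k$. In terms of its torus-invariant prime divisors $D_u$ $(u\in\mathrm{Gen}(\sigma))$, its canonical divisor is $K=-\sum_u D_u$, and a torus-invariant Weil divisor is Cartier if and only if it is of the form $\mathrm{div}(\chi^m)=\sum_u\langle m,u\rangle D_u$ with $m\in M$. Then $X_\sigma$ is * Gorenstein if $K$ is Cartier; * $\mathbb Q$-factorial if every torus-invariant Weil divisor has a positive multiple that is Cartier; * terminal if some positive multiple $rK=\mathrm{div}(\chi^m)$ of $K$ is Cartier and every torus-invariant exceptional divisor $E_v$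 over $X_\sigma$, that is, every primitive $v\in\sigma\cap N$ with $v\notin\mathrm{Gen}(\sigma)$, has positive discrepancy: $-1-\langle m,v\rangle/r>0$; * singular if $\sigma$ is singular. A moderate toric resolution of $\sigma$ is a (finite) fan $\Sigma$ with support $\sigma$ such that every nondegenerate cone $\tau\in\Sigma$ is smooth and the affine hyperplane spanned by $\mathrm{Gen}(\tau)$ intersects every one-dimensional face of $\sigma$. If $X_\sigma$ is singular, Gorenstein, terminal and $\mathbb Q$-factorial, then $\sigma$ (equivalently, $X_\sigma$) admits no moderate toric resolution. -/

import Mathlib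

open scoped TensorProduct

namespace Toric

section

variable {N : Type*} [AddCommGroup N]

/-- The lattice point `n ∈ N`, seen as a vector of `N_ℝ = ℝ ⊗ N`. -/
def vec (n : N) : ℝ ⊗[ℤ] N := (1 : ℝ) ⊗ₜ[ℤ] n

/-- Primitive elements of the lattice: `ε n ∉ N` for every `0 < ε < 1`. (So `0` is not primitive.) -/
def IsPrimitive (n : N) : Prop :=
  ∀ ε : ℝ, 0 < ε → ε < 1 → ε • vec n ∉ Set.range (vec : N → ℝ ⊗[ℤ] N)

/-- A strongly convex rational polyhedral cone in `N_ℝ`. -/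
structure IsToricCone (σ : PointedCone ℝ (ℝ ⊗[ℤ] N)) : Prop where
  rationalPolyhedral : ∃ s : Finset N, σ = PointedCone.hull ℝ (vec '' (s : Set N))
  stronglyConvex : (σ : ConvexCone ℝ (ℝ ⊗[ℤ] N)).Salient

/-- A nondegenerate cone is one that spans the whole space, i.e. has dimension `rank N`. -/
def IsNondegenerate (σ : PointedCone ℝ (ℝ ⊗[ℤ] N)) : Prop :=
  Submodule.span ℝ (σ : Set (ℝ ⊗[ℤ] N)) = ⊤

/-- The one-dimensional faces of a cone. -/
def rays (σ : PointedCone ℝ (ℝ ⊗[ℤ] N)) : Set (PointedCone ℝ (ℝ ⊗[ℤ] N)) :=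
  {ρ | ρ.IsFaceOf σ ∧ Module.finrank ℝ (Submodule.span ℝ (ρ : Set (ℝ ⊗[ℤ] N))) = 1}

/-- The minimal generators `Gen(σ)`: the primitive lattice points `n` such that `ℝ_{≥0} n` is a
one-dimensional face of `σ`. -/
def gen (σ : PointedCone ℝ (ℝ ⊗[ℤ] N)) : Set N :=
  {n | IsPrimitive n ∧ PointedCone.hull ℝ {vec n} ∈ rays σ}

/-- A cone is smooth if its minimal generators are part of a `ℤ`-basis of the lattice. For a
strongly convex rational polyhedral cone `σ` this says that the affine toric variety `X_σ` is
smooth; otherwise `σ` and `X_σ` are singular. -/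
def IsSmooth (σ : PointedCone ℝ (ℝ ⊗[ℤ] N)) : Prop :=
  ∃ b : Module.Basis (Fin (Module.finrank ℤ N)) ℤ N, gen σ ⊆ Set.range b

/-- Torus-invariant Weil divisors on `X_σ`: the torus-invariant prime divisors are the divisors
`D_u` of the rays `ℝ_{≥0} u`, `u ∈ Gen(σ)`, and `D` stands for `∑ u, D u • D_u`. -/
abbrev WeilDivisor (σ : PointedCone ℝ (ℝ ⊗[ℤ] N)) : Type _ := gen σ → ℤ

/-- The divisor `∑ u, ⟨m, u⟩ • D_u` of the character `χ^m`, `m ∈ M = Hom(N, ℤ)`, on `X_σ`. -/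
def characterDivisor (σ : PointedCone ℝ (ℝ ⊗[ℤ] N)) (m : Module.Dual ℤ N) : WeilDivisor σ :=
  fun u => m u

/-- Torus-invariant Cartier divisors on the affine toric variety `X_σ`: the divisors of
characters. -/
def IsCartier {σ : PointedCone ℝ (ℝ ⊗[ℤ] N)} (D : WeilDivisor σ) : Prop :=
  ∃ m : Module.Dual ℤ N, characterDivisor σ m = D

/-- `D` is `ℚ`-Cartier if some positive multiple of it is Cartier. -/
def IsQCartier {σ : PointedCone ℝ (ℝ ⊗[ℤ] N)} (D : WeilDivisor σ) : Prop :=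
  ∃ r : ℕ, 0 < r ∧ IsCartier (r • D)

/-- The canonical divisor `K = - ∑ u, D_u` of `X_σ`. -/
def canonicalDivisor (σ : PointedCone ℝ (ℝ ⊗[ℤ] N)) : WeilDivisor σ := fun _ => -1

/-- `X_σ` is `ℚ`-factorial: every Weil divisor on it is `ℚ`-Cartier. (Every Weil divisor on a
toric variety is linearly equivalent to a torus-invariant one.) -/
def IsQFactorial (σ : PointedCone ℝ (ℝ ⊗[ℤ] N)) : Prop :=
  ∀ D : WeilDivisor σ, IsQCartier D

/-- `X_σ` is Gorenstein: its canonical divisor is Cartier. -/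
def IsGorenstein (σ : PointedCone ℝ (ℝ ⊗[ℤ] N)) : Prop :=
  IsCartier (canonicalDivisor σ)

/-- The torus-invariant exceptional divisors `E_v` over `X_σ` are given by the primitive
`v ∈ σ ∩ N` that are not minimal generators of `σ`. -/
def exceptional (σ : PointedCone ℝ (ℝ ⊗[ℤ] N)) : Set N :=
  {v | IsPrimitive v ∧ vec v ∈ σ ∧ v ∉ gen σ}

/-- `X_σ` is terminal: `K` is `ℚ`-Cartier and all torus-invariant exceptional divisors `E_v` over
`X_σ` have positive discrepancy. If `r K = div (χ^m)` on `X_σ`, then on a toric variety `Z` over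
`X_σ` on which `E_v` is a divisor, `E_v` has coefficient `⟨m, v⟩ / r` in the pull-back of `K`
and `-1` in the canonical divisor of `Z`, so the discrepancy of `E_v` is `-1 - ⟨m, v⟩ / r`. -/
def IsTerminal (σ : PointedCone ℝ (ℝ ⊗[ℤ] N)) : Prop :=
  IsQCartier (canonicalDivisor σ) ∧
    ∀ (r : ℕ) (m : Module.Dual ℤ N), 0 < r → characterDivisor σ m = r • canonicalDivisor σ →
      ∀ v ∈ exceptional σ, (0 : ℚ) < -1 - (m v : ℚ) / (r : ℚ)

/-- A fan in `N_ℝ`. -/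
structure IsFan (S : Set (PointedCone ℝ (ℝ ⊗[ℤ] N))) : Prop where
  finite : S.Finite
  isToricCone : ∀ τ ∈ S, IsToricCone τ
  face_mem : ∀ τ ∈ S, ∀ φ : PointedCone ℝ (ℝ ⊗[ℤ] N), φ.IsFaceOf τ → φ ∈ S
  inter_face : ∀ τ₁ ∈ S, ∀ τ₂ ∈ S, (τ₁ ⊓ τ₂).IsFaceOf τ₁ ∧ (τ₁ ⊓ τ₂).IsFaceOf τ₂

/-- A subdivision of a cone `σ`: a fan with support `σ`. -/
structure IsSubdivision (S : Set (PointedCone ℝ (ℝ ⊗[ℤ] N)))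
    (σ : PointedCone ℝ (ℝ ⊗[ℤ] N)) : Prop where
  isFan : IsFan S
  support_eq : (⋃ τ ∈ S, (τ : Set (ℝ ⊗[ℤ] N))) = σ

/-- `S` is a moderate toric resolution of the nondegenerate cone `σ`: a subdivision of `σ` such
that each nondegenerate cone `τ` of it is smooth and the affine hyperplane spanned by `Gen(τ)`
meets every one-dimensional face of `σ`. -/
structure IsModerateResolution (S : Set (PointedCone ℝ (ℝ ⊗[ℤ] N)))
    (σ : PointedCone ℝ (ℝ ⊗[ℤ] N)) : Prop where
  isSubdivision : IsSubdivision S σ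
  smooth : ∀ τ ∈ S, IsNondegenerate τ → IsSmooth τ
  meets_rays : ∀ τ ∈ S, IsNondegenerate τ → ∀ ρ ∈ rays σ,
    ((affineSpan ℝ (vec '' gen τ) : Set (ℝ ⊗[ℤ] N)) ∩ ρ).Nonempty

end

end Toric

namespace Toric

/-! ### Convex geometry of real cones. -/

section RealCones

variable {V : Type*} [AddCommGroup V] [Module ℝ V]

/-! Some cone `τ` of a moderate resolution is nondegenerate, hence smooth, so an integral form `l`
is `1` on `gen τ`. The affine span of `gen τ` meets each ray of `σ`, which makes `l` positive, so at
least `1`, on `gen σ`. The Gorenstein form `m` is `-1` there, so `l + m ≥ 0` on all of `σ`. A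
generator of `τ` outside `gen σ` would have `m < -1` by terminality, hence `l + m < 0`; thus `gen τ
⊆ gen σ`. Since `gen τ` spans, `ℚ`-factoriality (`IsQFactorial.gen_subset`) leaves no further
generators in `σ`, and a basis containing `gen τ` shows that `σ` is smooth. -/

theorem mem_hull_singleton {x y : V} :
    y ∈ PointedCone.hull ℝ {x} ↔ ∃ a : ℝ, 0 ≤ a ∧ a • x = y := by
  rw [PointedCone.hull, Submodule.mem_span_singleton]
  exact ⟨fun ⟨a, h⟩ => ⟨a.1, a.2, h⟩, fun ⟨a, ha, h⟩ => ⟨⟨a, ha⟩, h⟩⟩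

theorem mem_hull_insert {x y : V} {T : Set V} :
    y ∈ PointedCone.hull ℝ (insert x T) ↔
      ∃ a : ℝ, 0 ≤ a ∧ ∃ z ∈ PointedCone.hull ℝ T, y = a • x + z := by
  rw [PointedCone.hull, Submodule.mem_span_insert]
  exact ⟨fun ⟨a, h⟩ => ⟨a.1, a.2, h⟩, fun ⟨a, ha, h⟩ => ⟨⟨a, ha⟩, h⟩⟩

theorem eq_zero_of_add_eq_zero {C : PointedCone ℝ V} (hC : (C : ConvexCone ℝ V).Salient)
    {x y : V} (hx : x ∈ C) (hy : y ∈ C) (h : x + y = 0) : x = 0 := by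
  by_contra hx0
  exact hC x hx hx0 (by rwa [← eq_neg_of_add_eq_zero_right h])

/-- In a salient cone, an irredundant generator spans a one-dimensional face. -/
theorem isFaceOf_hull_singleton {x : V} {T : Set V}
    (hC : (PointedCone.hull ℝ (insert x T) : ConvexCone ℝ V).Salient)
    (hx : x ∉ PointedCone.hull ℝ T) :
    (PointedCone.hull ℝ {x}).IsFaceOf (PointedCone.hull ℝ (insert x T)) := by
  have hTC : PointedCone.hull ℝ T ≤ PointedCone.hull ℝ (insert x T) :=
    Submodule.span_mono (Set.subset_insert x T)
  have hxC : x ∈ PointedCone.hull ℝ (insert x T) :=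
    PointedCone.subset_hull (Set.mem_insert x T)
  refine ⟨Submodule.span_mono (by simp), fun {y z a} hy hz ha hyz => ?_⟩
  obtain ⟨b, hb, y', hy', rfl⟩ := mem_hull_insert.1 hy
  obtain ⟨c, hc, z', hz', rfl⟩ := mem_hull_insert.1 hz
  obtain ⟨t, ht, h⟩ := mem_hull_singleton.1 hyz
  have hw : a • y' + z' ∈ PointedCone.hull ℝ T :=
    add_mem (PointedCone.smul_mem _ ha.le hy') hz'
  have key : (t - (a * b + c)) • x = a • y' + z' := by
    have : t • x - (a * b + c) • x = a • y' + z' := by rw [h]; module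
    rw [← this]; module
  -- A positive coefficient would put `x` in the hull of `T`. Otherwise `a • y'` plus an element of
  -- the cone is zero, and salience kills `y'`.
  rcases lt_or_ge 0 (t - (a * b + c)) with hpos | hneg
  · refine absurd ?_ hx
    have := PointedCone.smul_mem _ (inv_nonneg.2 hpos.le) hw
    rwa [← key, inv_smul_smul₀ hpos.ne'] at this
  · have h0 : a • y' = 0 := by
      refine eq_zero_of_add_eq_zero hC (PointedCone.smul_mem _ ha.le (hTC hy'))
        (add_mem (hTC hz') (PointedCone.smul_mem _ (neg_nonneg.2 hneg) hxC)) ?_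
      rw [neg_smul, key]; abel
    rw [(smul_eq_zero_iff_right ha.ne').1 h0, add_zero]
    exact mem_hull_singleton.2 ⟨b, hb, rfl⟩

theorem span_hull (s : Set V) :
    Submodule.span ℝ (PointedCone.hull ℝ s : Set V) = Submodule.span ℝ s :=
  le_antisymm (Submodule.span_le.2 (PointedCone.hull_le_span ℝ s))
    (Submodule.span_mono PointedCone.subset_hull)

theorem exists_sub_eq_of_mem_span {C : PointedCone ℝ V} {w : V}
    (hw : w ∈ Submodule.span ℝ (C : Set V)) : ∃ x ∈ C, ∃ y ∈ C, w = x - y := by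
  induction hw using Submodule.span_induction with
  | mem x hx => exact ⟨x, hx, 0, zero_mem C, by simp⟩
  | zero => exact ⟨0, zero_mem C, 0, zero_mem C, by simp⟩
  | add w₁ w₂ _ _ h₁ h₂ =>
    obtain ⟨x₁, hx₁, y₁, hy₁, rfl⟩ := h₁
    obtain ⟨x₂, hx₂, y₂, hy₂, rfl⟩ := h₂
    exact ⟨x₁ + x₂, add_mem hx₁ hx₂, y₁ + y₂, add_mem hy₁ hy₂, by abel⟩
  | smul a w _ h =>
    obtain ⟨x, hx, y, hy, rfl⟩ := h
    rcases le_total 0 a with ha | ha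
    · exact ⟨a • x, PointedCone.smul_mem _ ha hx, a • y, PointedCone.smul_mem _ ha hy,
        smul_sub a x y⟩
    · exact ⟨(-a) • y, PointedCone.smul_mem _ (neg_nonneg.2 ha) hy, (-a) • x,
        PointedCone.smul_mem _ (neg_nonneg.2 ha) hx, by module⟩

/-- A finite family of cones that covers a spanning cone has a spanning member. -/
theorem exists_span_eq_top_of_cover {C : PointedCone ℝ V} {S : Set (PointedCone ℝ V)}
    (hS : S.Finite) (hC : Submodule.span ℝ (C : Set V) = ⊤)
    (hcover : (C : Set V) ⊆ ⋃ τ ∈ S, (τ : Set V)) :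
    ∃ τ ∈ S, Submodule.span ℝ (τ : Set V) = ⊤ := by
  have : Finite S := hS
  suffices h : ∃ τ : S, Submodule.span ℝ ((τ : PointedCone ℝ V) : Set V) = ⊤ from
    ⟨_, h.choose.2, h.choose_spec⟩
  -- Finitely many subspaces covering a real vector space include the whole space. To place `x - y`
  -- in one of the spans, pigeonhole the segment from `y` to `x`: two of its points share a cone,
  -- and their difference is a nonzero multiple of `x - y`.
  refine Subspace.exists_eq_top_of_iUnion_eq_univ (Set.eq_univ_of_forall fun w => ?_)
  obtain ⟨x, hx, y, hy, rfl⟩ := exists_sub_eq_of_mem_span (hC ▸ Submodule.mem_top : w ∈ _)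
  have hmem : ∀ ε : Set.Icc (0 : ℝ) 1, ∃ τ : S, y + (ε : ℝ) • (x - y) ∈ (τ : PointedCone ℝ V) := by
    intro ε
    have h : y + (ε : ℝ) • (x - y) ∈ C := by
      have := add_mem (PointedCone.smul_mem C (sub_nonneg.2 ε.2.2) hy)
        (PointedCone.smul_mem C ε.2.1 hx)
      convert this using 1
      module
    obtain ⟨τ, hτ, h'⟩ := Set.mem_iUnion₂.1 (hcover h)
    exact ⟨⟨τ, hτ⟩, h'⟩
  choose f hf using hmem
  have : Infinite (Set.Icc (0 : ℝ) 1) := (Set.Icc_infinite zero_lt_one).to_subtype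
  obtain ⟨ε, δ, hne, hfe⟩ := Finite.exists_ne_map_eq_of_infinite f
  refine Set.mem_iUnion.2 ⟨f ε, ?_⟩
  have h₁ := Submodule.subset_span (R := ℝ) (hf ε)
  have h₂ := Submodule.subset_span (R := ℝ) (hf δ)
  rw [← hfe] at h₂
  have hsub : (ε : ℝ) - δ ≠ 0 := sub_ne_zero.2 fun h => hne (Subtype.ext h)
  have h₃ := Submodule.smul_mem _ ((ε : ℝ) - δ)⁻¹ (Submodule.sub_mem _ h₁ h₂)
  have h₄ : y + (ε : ℝ) • (x - y) - (y + (δ : ℝ) • (x - y)) = ((ε : ℝ) - δ) • (x - y) := by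
    module
  rwa [h₄, inv_smul_smul₀ hsub] at h₃

end RealCones

/-! ### Lattice points, minimal generators and divisors. -/

section Lattice

variable {N : Type*} [AddCommGroup N]

theorem vec_zero : vec (0 : N) = 0 := TensorProduct.tmul_zero _ _

theorem vec_zsmul (d : ℤ) (n : N) : vec (d • n) = (d : ℝ) • vec n := by
  rw [vec, TensorProduct.tmul_smul, vec, Int.cast_smul_eq_zsmul]

/-- The real linear form on `N_ℝ` that extends an integral linear form on `N`. -/
noncomputable def realForm (m : Module.Dual ℤ N) : ℝ ⊗[ℤ] N →ₗ[ℝ] ℝ :=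
  Module.Dual.baseChange ℝ m

@[simp]
theorem realForm_vec (m : Module.Dual ℤ N) (n : N) : realForm m (vec n) = m n := by
  simp [realForm, vec, Module.Dual.baseChange]

theorem isPrimitive_of_dual_eq_one {n : N} (m : Module.Dual ℤ N) (h : m n = 1) :
    IsPrimitive n := by
  rintro ε h0 h1 ⟨k, hk⟩
  have := congrArg (realForm m) hk
  rw [map_smul, realForm_vec, realForm_vec, h, smul_eq_mul, Int.cast_one, mul_one] at this
  rw [← this] at h0 h1
  have h0' : 0 < m k := by exact_mod_cast h0
  have h1' : m k < 1 := by exact_mod_cast h1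
  omega

/-- The values at `n` of all integral forms make up an ideal `(g)`. Dividing `n` by `g` gives a
point on which some form is `1`, hence a primitive one. -/
theorem exists_pos_smul_isPrimitive [Module.Free ℤ N] [Module.Finite ℤ N] {n : N} (hn : n ≠ 0) :
    ∃ (d : ℤ) (p : N), 0 < d ∧ IsPrimitive p ∧ n = d • p := by
  let b := Module.Free.chooseBasis ℤ N
  obtain ⟨g, hg⟩ := (IsPrincipalIdealRing.principal
    (LinearMap.range (Module.Dual.eval ℤ N n) : Ideal ℤ)).principal
  have hdvd : ∀ m : Module.Dual ℤ N, g ∣ m n := fun m => by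
    have : m n ∈ (LinearMap.range (Module.Dual.eval ℤ N n) : Ideal ℤ) := ⟨m, rfl⟩
    rw [hg] at this
    exact Ideal.mem_span_singleton.1 this
  obtain ⟨m, hm⟩ : ∃ m : Module.Dual ℤ N, m n = g := by
    have : g ∈ (LinearMap.range (Module.Dual.eval ℤ N n) : Ideal ℤ) := by
      rw [hg]
      exact Submodule.mem_span_singleton_self g
    exact this
  choose c hc using fun i => hdvd (b.coord i)
  have hnp : n = g • ∑ i, c i • b i := by
    conv_lhs => rw [← b.sum_repr n]
    rw [Finset.smul_sum]
    exact Finset.sum_congr rfl fun i _ => by rw [smul_smul, ← hc i, b.coord_apply]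
  have hg0 : g ≠ 0 := fun h => hn (by rw [hnp, h, zero_smul])
  have hm1 : m (∑ i, c i • b i) = 1 := by
    refine mul_left_cancel₀ hg0 ?_
    rw [← smul_eq_mul, ← map_smul, ← hnp, hm, mul_one]
  rcases lt_or_gt_of_ne hg0 with h | h
  · exact ⟨-g, -∑ i, c i • b i, neg_pos.2 h,
      isPrimitive_of_dual_eq_one (-m) (by simpa using hm1), by rw [neg_smul_neg, ← hnp]⟩
  · exact ⟨g, _, h, isPrimitive_of_dual_eq_one m hm1, hnp⟩

variable {σ : PointedCone ℝ (ℝ ⊗[ℤ] N)}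

theorem vec_mem_of_mem_gen {n : N} (hn : n ∈ gen σ) : vec n ∈ σ :=
  hn.2.1.le (PointedCone.subset_hull rfl)

/-- A strongly convex rational polyhedral cone is generated by its minimal generators. -/
theorem IsToricCone.hull_gen [Module.Free ℤ N] [Module.Finite ℤ N] (hσ : IsToricCone σ) :
    PointedCone.hull ℝ (vec '' gen σ) = σ := by
  classical
  refine le_antisymm (Submodule.span_le.2 ?_) ?_
  · rintro _ ⟨n, hn, rfl⟩
    exact vec_mem_of_mem_gen hn
  -- In a minimal finite generating set no element is redundant, so each one spans a ray.
  obtain ⟨s, hs, hmin⟩ := (wellFounded_lt (α := Finset N)).has_min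
    {s : Finset N | σ = PointedCone.hull ℝ (vec '' (s : Set N))} hσ.rationalPolyhedral
  rw [Set.mem_ofPred_eq] at hs
  conv_lhs => rw [hs]
  refine Submodule.span_le.2 ?_
  rintro _ ⟨n, hn, rfl⟩
  have hins : vec '' (s : Set N) = insert (vec n) (vec '' (s.erase n : Set N)) := by
    rw [← Set.image_insert_eq, ← Finset.coe_insert, Finset.insert_erase hn]
  have hn' : vec n ∉ PointedCone.hull ℝ (vec '' (s.erase n : Set N)) := fun h => by
    refine hmin (s.erase n) ?_ (Finset.erase_ssubset hn)
    rw [Set.mem_ofPred_eq, hs, hins]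
    exact Submodule.span_insert_eq_span h
  have hface : (PointedCone.hull ℝ {vec n}).IsFaceOf σ := by
    have hsal := hσ.stronglyConvex
    rw [hs, hins] at hsal ⊢
    exact isFaceOf_hull_singleton hsal hn'
  have hvn : vec n ≠ 0 := fun h => hn' (h ▸ zero_mem _)
  obtain ⟨d, p, hd, hp, rfl⟩ := exists_pos_smul_isPrimitive (n := n)
    fun h => hvn (h ▸ vec_zero)
  have hd' : (0 : ℝ) < d := by exact_mod_cast hd
  have hmem : vec p ∈ PointedCone.hull ℝ {vec (d • p)} := mem_hull_singleton.2
    ⟨(d : ℝ)⁻¹, inv_nonneg.2 hd'.le, by rw [vec_zsmul, inv_smul_smul₀ hd'.ne']⟩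
  have hmem' : vec (d • p) ∈ PointedCone.hull ℝ {vec p} := mem_hull_singleton.2
    ⟨d, hd'.le, (vec_zsmul d p).symm⟩
  have heq : PointedCone.hull ℝ {vec (d • p)} = PointedCone.hull ℝ {vec p} :=
    le_antisymm (Submodule.span_le.2 (Set.singleton_subset_iff.2 hmem'))
      (Submodule.span_le.2 (Set.singleton_subset_iff.2 hmem))
  have hpg : p ∈ gen σ := by
    refine ⟨hp, heq ▸ hface, ?_⟩
    rw [span_hull]
    refine finrank_span_singleton fun h => hvn ?_
    rw [vec_zsmul, h, smul_zero]
  exact Submodule.span_mono (Set.singleton_subset_iff.2 (Set.mem_image_of_mem _ hpg)) hmem'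

theorem IsToricCone.span_gen [Module.Free ℤ N] [Module.Finite ℤ N] (hσ : IsToricCone σ)
    (hnd : IsNondegenerate σ) : Submodule.span ℝ (vec '' gen σ) = ⊤ := by
  rw [← span_hull, hσ.hull_gen, hnd]

/-- The sum of the coordinates in a basis containing the minimal generators. -/
theorem IsSmooth.exists_dual_eq_one (hσ : IsSmooth σ) :
    ∃ l : Module.Dual ℤ N, ∀ n ∈ gen σ, l n = 1 := by
  obtain ⟨b, hb⟩ := hσ
  refine ⟨b.constr ℤ fun _ => 1, fun n hn => ?_⟩
  obtain ⟨i, rfl⟩ := hb hn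
  exact b.constr_basis ℤ _ i

/-- An integral form that is `1` on an affine subspace meeting the ray of a minimal generator
is at least `1` on that generator. -/
theorem one_le_of_affineSpan_inter_nonempty {A : Set N} {l : Module.Dual ℤ N}
    (hl : ∀ n ∈ A, l n = 1) {u : N}
    (h : ((affineSpan ℝ (vec '' A) : Set (ℝ ⊗[ℤ] N)) ∩ PointedCone.hull ℝ {vec u}).Nonempty) :
    1 ≤ l u := by
  obtain ⟨x, hxA, hxu⟩ := h
  obtain ⟨a, ha, rfl⟩ := mem_hull_singleton.1 hxu
  have hle : affineSpan ℝ (vec '' A) ≤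
      (AffineSubspace.mk' (1 : ℝ) ⊥).comap (realForm l).toAffineMap := by
    rw [affineSpan_le]
    rintro _ ⟨n, hn, rfl⟩
    simp [AffineSubspace.mem_mk', hl n hn]
  have h1 : a * l u = 1 := by
    simpa [AffineSubspace.mem_mk', sub_eq_zero] using hle hxA
  have : (0 : ℝ) < l u := by
    by_contra! h
    linarith [mul_nonpos_of_nonneg_of_nonpos ha h]
  exact_mod_cast this

theorem realForm_nonneg [Module.Free ℤ N] [Module.Finite ℤ N] (hσ : IsToricCone σ)
    {m : Module.Dual ℤ N} (hm : ∀ u ∈ gen σ, 0 ≤ m u) {x : ℝ ⊗[ℤ] N} (hx : x ∈ σ) :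
    0 ≤ realForm m x := by
  have hle : σ ≤ (PointedCone.positive ℝ ℝ).comap (realForm m) := by
    conv_lhs => rw [← hσ.hull_gen]
    refine Submodule.span_le.2 ?_
    rintro _ ⟨u, hu, rfl⟩
    simpa [PointedCone.mem_comap, PointedCone.mem_positive] using hm u hu
  simpa [PointedCone.mem_comap, PointedCone.mem_positive] using hle hx

/-- On a `ℚ`-factorial affine toric variety, minimal generators that span the ambient space are
all the minimal generators. -/
theorem IsQFactorial.gen_subset (hσ : IsQFactorial σ) {A : Set N} (hA : A ⊆ gen σ)
    (hspan : Submodule.span ℝ (vec '' A) = ⊤) : gen σ ⊆ A := by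
  classical
  intro u hu
  by_contra huA
  -- If `r • D_u` is the divisor of `m`, then `m` vanishes on the spanning set `A`, hence
  -- everywhere, although `m u = r > 0`.
  obtain ⟨r, hr, m, hm⟩ := hσ (Pi.single ⟨u, hu⟩ 1)
  have hzero : realForm m = 0 := by
    refine LinearMap.ext_on hspan ?_
    rintro _ ⟨v, hv, rfl⟩
    have hne : (⟨v, hA hv⟩ : gen σ) ≠ ⟨u, hu⟩ := fun h =>
      huA (Subtype.mk.inj h ▸ hv)
    have := congrFun hm ⟨v, hA hv⟩
    simp only [characterDivisor, Pi.smul_apply, Pi.single_eq_of_ne hne, smul_zero] at this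
    simp [this]
  have h0 : m u = 0 := by
    have := realForm_vec m u
    rw [hzero, LinearMap.zero_apply] at this
    exact_mod_cast this.symm
  have := congrFun hm ⟨u, hu⟩
  simp only [characterDivisor, Pi.smul_apply, Pi.single_eq_same, h0] at this
  simp at this
  omega

end Lattice

end Toric

/-! ### The nonexistence theorem. -/

theorem corollary3p5 {N : Type*} [AddCommGroup N] [Module.Free ℤ N] [Module.Finite ℤ N]
    (hN : Module.finrank ℤ N = 4)
    (σ : PointedCone ℝ (ℝ ⊗[ℤ] N)) (hσ : Toric.IsToricCone σ) (hnd : Toric.IsNondegenerate σ)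
    (hgor : Toric.IsGorenstein σ) (hterm : Toric.IsTerminal σ) (hQ : Toric.IsQFactorial σ)
    (hsing : ¬ Toric.IsSmooth σ) :
    ¬ ∃ S : Set (PointedCone ℝ (ℝ ⊗[ℤ] N)), Toric.IsModerateResolution S σ := by
  rintro ⟨S, hS⟩
  obtain ⟨m, hm⟩ := hgor
  have hmu : ∀ u ∈ Toric.gen σ, m u = -1 := fun u hu => congrFun hm ⟨u, hu⟩
  obtain ⟨τ, hτS, hτ⟩ := Toric.exists_span_eq_top_of_cover hS.isSubdivision.isFan.finite hnd
    hS.isSubdivision.support_eq.ge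
  have hτσ : ∀ x ∈ τ, x ∈ σ := fun x hx =>
    hS.isSubdivision.support_eq.le (Set.mem_biUnion hτS hx)
  obtain ⟨l, hl⟩ := (hS.smooth τ hτS hτ).exists_dual_eq_one
  have hlu : ∀ u ∈ Toric.gen σ, 0 ≤ (l + m) u := fun u hu => by
    have := Toric.one_le_of_affineSpan_inter_nonempty hl (hS.meets_rays τ hτS hτ _ hu.2)
    rw [LinearMap.add_apply, hmu u hu]
    linarith
  have hsub : Toric.gen τ ⊆ Toric.gen σ := fun v hv => by
    by_contra hvσ
    have hvm := hτσ _ (Toric.vec_mem_of_mem_gen hv)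
    have h₁ := Toric.realForm_nonneg hσ hlu hvm
    rw [Toric.realForm_vec, LinearMap.add_apply, hl v hv] at h₁
    -- As `K` itself is Cartier, `r = 1` is allowed, and the discrepancy bound reads `m v < -1`.
    have h₂ := hterm.2 1 m one_pos (by rw [hm, one_smul]) v ⟨hv.1, hvm, hvσ⟩
    have h₁' : 0 ≤ 1 + m v := by exact_mod_cast h₁
    have h₁'' : (0 : ℚ) ≤ 1 + m v := by exact_mod_cast h₁'
    norm_num at h₂
    linarith
  have hspan := (hS.isSubdivision.isFan.isToricCone τ hτS).span_gen hτ
  obtain ⟨b, hb⟩ := hS.smooth τ hτS hτ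
  exact hsing ⟨b, (hQ.gen_subset hsub hspan).trans hb⟩
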